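/- Let $K$ be a positive integer, $\mathcal K=\{1,\dots,K\}$, let $\mathcal Q,\mathcal V_1,\dots,\mathcal V_K,\mathcal Z$ be finite alphabets, let $R_{v,i}\ge 0$ for $i\in\mathcal K$, and let $(Q,V_1,\dots,V_K,Z)\sim p(q)\prod_{i\in\mathcal K}p(v_i|q)\,p(z|v_1,\dots,v_K)$ take values in these alphabets. For $\mathcal J\subseteq\mathcal K$ write $V_{\mathcal J}=(V_j)_{j\in\mathcal J}$; entropies and mutual informations are in bits. Suppose that $$\sum_{j\in\mathcal J}R_{v,j}\ \ge\ I(V_{\mathcal J};Z|Q)\qquad\text{for all }\mathcal J\subseteq\mathcal K .$$ For $\epsilon>0$ let $\mathcal T^n_\epsilon=\mathcal T_\epsilon^n(Q,V_1,\dots,V_K,Z)$ be the jointly (robustly) typical set: the set of sequences $(q^n,v_1^n,\dots,v_K^n,z^n)$ such that, for every letter $a=(q,v_1,\dots,v_K,z)$, the fraction of positions at which the letter $a$ occurs differs from $p(a)=\Pr\{(Q,V_1,\dots,V_K,Z)=a\}$ by at most $\epsilon\,p(a)$. Then there is a function $\delta_n(\epsilon)$ with $\delta_n(\epsilon)\to0$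 as $\epsilon\to0^+$ and $n\to\infty$ (jointly), such that the following holds for every $\epsilon>0$. For each $n$ let $Q^n$ be distributed according to $\prod_{t=1}^n p(q(t))$; let $V_i^n(l_i)$, $i\in\mathcal K$, $l_i\in[1:2^{nR_{v,i}}]=\{1,\dots,\lfloor 2^{nR_{v,i}}\rfloor\}$, be random sequences that are conditionally independent given $Q^n$, each with conditional distribution $\prod_{t=1}^n p(v_i(t)|q(t))$; let $\mathcal C=(Q^n,V_1^n(1),\dots,V_K^n(\lfloor 2^{nR_{v,K}}\rfloor))$ be the codebook; let $L_i\in[1:2^{nR_{v,i}}]$, $i\in\mathcal K$, be random indices and let $Z^n\in\mathcal Z^n$ be a random sequence, where the joint distribution of $(L_1,\dots,L_K,Z^n)$ given $\mathcal C$ is arbitrary. If $$\Pr\{(Q^n,V_1^n(L_1),\dots,V_K^n(L_K),Z^n)\in\mathcal T^n_\epsilon\}\to1\quad\text{as }n\to\infty,$$ then for all sufficiently large $n$ $$H(L_1,\dots,L_K|Z^n,Q^n,\mathcal C)\ \le\ n\Big[\sum_{j\in\mathcal K}R_{v,j}-I(V_{\mathcal K};Z|Q)\Big]+n\,\delta_n(\epsilon).$$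 -/

import Mathlib

open MeasureTheory ProbabilityTheory Filter Topology

namespace Equivocation

noncomputable section

/-! ### Information measures (in bits) of finite-valued random variables -/

section Information

variable {Ω α β γ : Type*} [MeasurableSpace Ω]

/-- Shannon entropy `H(X) = - ∑ₓ P(X = x) log₂ P(X = x)`. -/
def entropy [Fintype α] (P : Measure Ω) (X : Ω → α) : ℝ :=
  -∑ x, P.real (X ⁻¹' {x}) * Real.logb 2 (P.real (X ⁻¹' {x}))

/-- Conditional entropy `H(X | Y) = ∑_y P(Y = y) H(X | Y = y)`. -/
def condEntropy [Fintype α] [Fintype β] (P : Measure Ω) (X : Ω → α) (Y : Ω → β) : ℝ :=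
  ∑ y, P.real (Y ⁻¹' {y}) * entropy (P[|Y ⁻¹' {y}]) X

/-- Conditional mutual information `I(X; Y | W) = H(X | W) - H(X | Y, W)`. -/
def condMutualInfo [Fintype α] [Fintype β] [Fintype γ]
    (P : Measure Ω) (X : Ω → α) (Y : Ω → β) (W : Ω → γ) : ℝ :=
  condEntropy P X W - condEntropy P X (fun ω => (Y ω, W ω))

/-- The (robustly) typical set `𝒯_ε^n(X)`: the sequences `x^n` with
`|π(a | x^n) - P(X = a)| ≤ ε P(X = a)` for all letters `a`, where `π(a | x^n)` is the fraction
of positions at which `x^n` equals `a`. -/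
def typicalSet (P : Measure Ω) (X : Ω → α) (ε : ℝ) (n : ℕ) : Set (Fin n → α) :=
  {x | ∀ a, |({t | x t = a}.ncard : ℝ) / n - P.real (X ⁻¹' {a})| ≤ ε * P.real (X ⁻¹' {a})}

end Information

section Model

variable {K : ℕ} {𝒬 𝒵 : Type*} {𝒱 : Fin K → Type*}

/-- `(Q, V₁, …, V_K, Z) ∼ p(q) ∏ᵢ p(vᵢ | q) p(z | v₁, …, v_K)`. -/
def HasSourceLaw {Ω : Type*} [MeasurableSpace Ω] (P : Measure Ω)
    (pQ : PMF 𝒬) (pV : ∀ i, 𝒬 → PMF (𝒱 i)) (pZ : (∀ i, 𝒱 i) → PMF 𝒵)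
    (Q : Ω → 𝒬) (V : ∀ i, Ω → 𝒱 i) (Z : Ω → 𝒵) : Prop :=
  ∀ (q : 𝒬) (v : ∀ i, 𝒱 i) (z : 𝒵),
    P {ω | Q ω = q ∧ (∀ i, V i ω = v i) ∧ Z ω = z} = pQ q * (∏ i, pV i q (v i)) * pZ v z

/-- `⌊2^{nR}⌋`, the number of elements of the index set `[1 : 2^{nR}]`. -/
def numIdx (n : ℕ) (R : ℝ) : ℕ := ⌊(2 : ℝ) ^ ((n : ℝ) * R)⌋₊

/-- `Q^n` is i.i.d. `p(q)`, and, given `Q^n`, the codewords `V_i^n(l)` (over all `i` and `l`) are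
conditionally independent, each with conditional law `∏ₜ p(v_i(t) | q(t))`. -/
structure IsRandomCodebook {Ω : Type*} [MeasurableSpace Ω] (μ : Measure Ω)
    [MeasurableSpace 𝒬] [∀ i, MeasurableSpace (𝒱 i)]
    (pQ : PMF 𝒬) (pV : ∀ i, 𝒬 → PMF (𝒱 i)) {n : ℕ} {M : Fin K → ℕ}
    (Qn : Ω → Fin n → 𝒬) (Vn : ∀ i, Fin (M i) → Ω → Fin n → 𝒱 i) : Prop where
  measurable_Q : Measurable Qn
  measurable_V : ∀ i l, Measurable (Vn i l)
  law_Q : ∀ q : Fin n → 𝒬, μ (Qn ⁻¹' {q}) = ∏ t, pQ (q t)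
  law_V : ∀ q : Fin n → 𝒬, μ (Qn ⁻¹' {q}) ≠ 0 → ∀ i l (v : Fin n → 𝒱 i),
    μ[|Qn ⁻¹' {q}] (Vn i l ⁻¹' {v}) = ∏ t, pV i (q t) (v t)
  condIndep : ∀ q : Fin n → 𝒬, μ (Qn ⁻¹' {q}) ≠ 0 →
    iIndepFun (fun x : (i : Fin K) × Fin (M i) => Vn x.1 x.2) (μ[|Qn ⁻¹' {q}])

/-- The codebook `𝒞 = (Q^n, V_1^n(1), …, V_K^n(2^{nR_K}))` as a random variable. -/
def codebook {Ω : Type*} {n : ℕ} {M : Fin K → ℕ}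
    (Qn : Ω → Fin n → 𝒬) (Vn : ∀ i, Fin (M i) → Ω → Fin n → 𝒱 i) (ω : Ω) :
    (Fin n → 𝒬) × (∀ i, Fin (M i) → Fin n → 𝒱 i) :=
  (Qn ω, fun i l => Vn i l ω)

end Model

end

end Equivocation

/-!
For a fixed `z`, let `N(z)` be the number of index tuples `l` whose codewords are jointly typical
with `Q^n` and `z`. If `L` lies in the list of length `N(Z^n)` except with small probability, then
Gibbs' inequality gives `H(L | Z^n, Q^n, 𝒞) ≤ E log₂ N(Z^n)` up to negligible terms
(`condEntropy_le_of_integral_ncard_pow_le`), so it suffices that `N(Z^n)` is at most about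
`2^{n (∑ R - I(V_K; Z | Q))}`. As `Z^n` may depend on the codebook in any way, a bound is needed
that survives a sum over all `|𝒵|^n` sequences `z`. The mean and the variance of `N(z)` are too
weak for that, but the `n`-th moment is enough: after taking the `n`-th root, the sum over `z`
costs a factor `|𝒵|` only (`IsRandomCodebook.integral_ncard_pow_le_of_dependent`).

The `m`-th moment of `N(z)` is the expected number of `m`-tuples of typical index tuples. These
are added one at a time (`sum_measureReal_forall_le`). If the coordinates in `D` of a new index
tuple have been used before and the others have not, then there are at most
`m^{|D|} ∏_{i ∉ D} 2^{n R_i}` such tuples, and given the codewords used before, each is typical with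
probability at most `2^{-n (I(V_K; Z | Q) - I(V_D; Z | Q) - O(ε))}` (`sum_typical_prod_le`): the
exponent is `I(V_{Dᶜ}; V_D, Z | Q)`, because the `V_i` are independent given `Q`. The rate constraint
`∑_{j ∈ D} R_j ≥ I(V_D; Z | Q)` turns the product of the two into at most
`m^K 2^{n (∑ R - I(V_K; Z | Q) + O(ε))}`, for every `D` (`sum_card_mul_packing_le`).
-/

namespace Equivocation

/-! ### Expectations of finite-valued random variables -/

section FiniteValued

variable {Ω α β : Type*} [MeasurableSpace Ω] [Fintype α] [Fintype β]

theorem integrable_comp_of_fintype (P : Measure Ω) [IsFiniteMeasure P] {X : Ω → α}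
    (hX : ∀ x, MeasurableSet (X ⁻¹' {x})) (g : α → ℝ) : Integrable (fun ω => g (X ω)) P := by
  let _ : MeasurableSpace α := ⊤
  have hXm : Measurable X := measurable_to_countable' hX
  exact (Integrable.of_finite (μ := P.map X) (f := g)).comp_measurable hXm

theorem integral_comp_eq_sum (P : Measure Ω) [IsFiniteMeasure P] {X : Ω → α}
    (hX : ∀ x, MeasurableSet (X ⁻¹' {x})) (g : α → ℝ) :
    ∫ ω, g (X ω) ∂P = ∑ x, P.real (X ⁻¹' {x}) * g x := by
  let _ : MeasurableSpace α := ⊤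
  have hXm : Measurable X := measurable_to_countable' hX
  rw [← integral_map (f := g) hXm.aemeasurable (by fun_prop), integral_fintype .of_finite]
  refine Finset.sum_congr rfl fun x _ => ?_
  rw [map_measureReal_apply hXm (by trivial), smul_eq_mul]

theorem measurableSet_preimage_prodMk {Ω α β : Type*} [MeasurableSpace Ω] {X : Ω → α} {Y : Ω → β}
    (hX : ∀ x, MeasurableSet (X ⁻¹' {x})) (hY : ∀ y, MeasurableSet (Y ⁻¹' {y})) (p : α × β) :
    MeasurableSet ((fun ω => (X ω, Y ω)) ⁻¹' {p}) := by
  have : (fun ω => (X ω, Y ω)) ⁻¹' {p} = X ⁻¹' {p.1} ∩ Y ⁻¹' {p.2} := by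
    ext ω; simp [Prod.ext_iff]
  rw [this]
  exact (hX _).inter (hY _)

/-! ### Conditional entropy as an expectation, and Gibbs' inequality -/

theorem condEntropy_eq_sum (P : Measure Ω) [IsFiniteMeasure P] {X : Ω → α} {Y : Ω → β}
    (hY : ∀ y, MeasurableSet (Y ⁻¹' {y})) :
    condEntropy P X Y = ∑ y, ∑ x, P.real ((fun ω => (X ω, Y ω)) ⁻¹' {(x, y)}) *
      -Real.logb 2 (P.real ((fun ω => (X ω, Y ω)) ⁻¹' {(x, y)}) / P.real (Y ⁻¹' {y})) := by
  unfold condEntropy entropy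
  refine Finset.sum_congr rfl fun y _ => ?_
  rw [← Finset.sum_neg_distrib, Finset.mul_sum]
  refine Finset.sum_congr rfl fun x _ => ?_
  have hpre : (fun ω => (X ω, Y ω)) ⁻¹' {(x, y)} = Y ⁻¹' {y} ∩ X ⁻¹' {x} := by
    ext ω; simp [and_comm]
  have hcond : (P[|Y ⁻¹' {y}]).real (X ⁻¹' {x}) =
      (P.real (Y ⁻¹' {y}))⁻¹ * P.real (Y ⁻¹' {y} ∩ X ⁻¹' {x}) := by
    simp [Measure.real, cond_apply (hY y), ENNReal.toReal_mul, ENNReal.toReal_inv]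
  rw [hcond, hpre]
  rcases eq_or_ne (P.real (Y ⁻¹' {y})) 0 with h | h
  · have : P.real (Y ⁻¹' {y} ∩ X ⁻¹' {x}) = 0 :=
      le_antisymm (h ▸ measureReal_mono Set.inter_subset_left) measureReal_nonneg
    simp [h, this]
  · rw [inv_mul_eq_div]
    field_simp

theorem condEntropy_eq_integral (P : Measure Ω) [IsFiniteMeasure P] {X : Ω → α} {Y : Ω → β}
    (hX : ∀ x, MeasurableSet (X ⁻¹' {x})) (hY : ∀ y, MeasurableSet (Y ⁻¹' {y})) :
    condEntropy P X Y = ∫ ω, -Real.logb 2 (P.real ((fun ω => (X ω, Y ω)) ⁻¹' {(X ω, Y ω)}) /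
      P.real (Y ⁻¹' {Y ω})) ∂P := by
  rw [condEntropy_eq_sum P hY, integral_comp_eq_sum P (measurableSet_preimage_prodMk hX hY)
    (fun p => -Real.logb 2 (P.real ((fun ω => (X ω, Y ω)) ⁻¹' {p}) / P.real (Y ⁻¹' {p.2}))),
    Fintype.sum_prod_type_right]

/-- Gibbs' inequality: describing `X` with a positive conditional sub-probability mass function
`r` costs at least the conditional entropy. -/
theorem condEntropy_le_integral (P : Measure Ω) [IsFiniteMeasure P] {X : Ω → α} {Y : Ω → β}
    (hX : ∀ x, MeasurableSet (X ⁻¹' {x})) (hY : ∀ y, MeasurableSet (Y ⁻¹' {y}))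
    {r : α → β → ℝ} (hr : ∀ x y, 0 < r x y) (hr1 : ∀ y, ∑ x, r x y ≤ 1) :
    condEntropy P X Y ≤ ∫ ω, -Real.logb 2 (r (X ω) (Y ω)) ∂P := by
  have hXY := measurableSet_preimage_prodMk hX hY
  rw [condEntropy_eq_sum P hY, integral_comp_eq_sum P hXY
    (fun p => -Real.logb 2 (r p.1 p.2)), Fintype.sum_prod_type_right]
  refine Finset.sum_le_sum fun y _ => ?_
  have hmarg : ∑ x, P.real ((fun ω => (X ω, Y ω)) ⁻¹' {(x, y)}) = P.real (Y ⁻¹' {y}) := by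
    rw [← measureReal_biUnion_finset]
    · congr 1
      ext ω
      simp
    · intro a _ b _ hab
      refine Set.disjoint_left.2 fun ω h1 h2 => hab ?_
      simp only [Set.mem_preimage, Set.mem_singleton_iff, Prod.mk.injEq] at h1 h2
      exact h1.1.symm.trans h2.1
    · exact fun x _ => hXY _
  have key : ∀ x, P.real ((fun ω => (X ω, Y ω)) ⁻¹' {(x, y)}) *
      -Real.logb 2 (P.real ((fun ω => (X ω, Y ω)) ⁻¹' {(x, y)}) / P.real (Y ⁻¹' {y})) ≤
      P.real ((fun ω => (X ω, Y ω)) ⁻¹' {(x, y)}) * -Real.logb 2 (r x y) +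
      (r x y * P.real (Y ⁻¹' {y}) - P.real ((fun ω => (X ω, Y ω)) ⁻¹' {(x, y)})) /
        Real.log 2 := by
    intro x
    have hle : P.real ((fun ω => (X ω, Y ω)) ⁻¹' {(x, y)}) ≤ P.real (Y ⁻¹' {y}) :=
      measureReal_mono fun ω h => by
        simp only [Set.mem_preimage, Set.mem_singleton_iff, Prod.mk.injEq] at h ⊢
        exact h.2
    set a := P.real ((fun ω => (X ω, Y ω)) ⁻¹' {(x, y)}) with ha
    set b := P.real (Y ⁻¹' {y})
    have hl2 : 0 < Real.log 2 := Real.log_pos one_lt_two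
    rcases (measureReal_nonneg (μ := P)
      (s := (fun ω => (X ω, Y ω)) ⁻¹' {(x, y)})).eq_or_lt with h0 | h0
    · rw [← ha] at h0
      rw [← h0] at hle ⊢
      simp only [zero_mul, sub_zero, zero_add]
      have := (hr x y).le
      positivity
    · rw [← ha] at h0
      have hb : 0 < b := h0.trans_le hle
      have h1 := Real.log_le_sub_one_of_pos (x := r x y * b / a)
        (by have := hr x y; positivity)
      rw [Real.log_div (mul_pos (hr x y) hb).ne' h0.ne', Real.log_mul (hr x y).ne' hb.ne'] at h1
      have h2 := mul_le_mul_of_nonneg_left h1 h0.le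
      have h3 : a * (r x y * b / a - 1) = r x y * b - a := by field_simp
      rw [h3] at h2
      have h4 := div_le_div_of_nonneg_right h2 hl2.le
      rw [Real.logb, Real.logb, Real.log_div h0.ne' hb.ne']
      have h5 : a * -((Real.log a - Real.log b) / Real.log 2) =
        a * -(Real.log (r x y) / Real.log 2) +
          a * (Real.log (r x y) + Real.log b - Real.log a) / Real.log 2 := by
        field_simp
        ring
      rw [h5]
      linarith
  refine (Finset.sum_le_sum fun x _ => key x).trans ?_
  rw [Finset.sum_add_distrib, ← Finset.sum_div, Finset.sum_sub_distrib, ← Finset.sum_mul, hmarg]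
  have : (∑ x, r x y) * P.real (Y ⁻¹' {y}) - P.real (Y ⁻¹' {y}) ≤ 0 := by
    nlinarith [hr1 y, measureReal_nonneg (μ := P) (s := Y ⁻¹' {y})]
  have := div_nonpos_of_nonpos_of_nonneg this (Real.log_pos one_lt_two).le
  linarith

end FiniteValued

/-! ### Moments of the number of typical codeword tuples -/

section Moments

/-- If `g` is independent of `f`, and each of the events `g ∈ B a` has probability at most `c`,
then requiring `g ∈ B (f ω)` costs a factor `c`. -/
theorem measureReal_and_mem_le_of_indepFun {Ω α β : Type*} [MeasurableSpace Ω]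
    {ν : Measure Ω} [IsFiniteMeasure ν] [Finite α] [MeasurableSpace α]
    [DiscreteMeasurableSpace α] [MeasurableSpace β] [DiscreteMeasurableSpace β]
    {f : Ω → α} {g : Ω → β} (hf : Measurable f) (hfg : IndepFun f g ν)
    (A : Set α) (B : α → Set β) {c : ℝ} (hc : ∀ ω, ν.real (g ⁻¹' B (f ω)) ≤ c) :
    ν.real {ω | f ω ∈ A ∧ g ω ∈ B (f ω)} ≤ ν.real (f ⁻¹' A) * c := by
  classical
  have := Fintype.ofFinite α
  have hsub : {ω | f ω ∈ A ∧ g ω ∈ B (f ω)} ⊆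
      ⋃ a ∈ A.toFinset, f ⁻¹' {a} ∩ g ⁻¹' B a := by
    intro ω hω
    simp only [Set.mem_toFinset, Set.mem_iUnion]
    exact ⟨f ω, hω.1, rfl, hω.2⟩
  calc ν.real {ω | f ω ∈ A ∧ g ω ∈ B (f ω)}
      ≤ ∑ a ∈ A.toFinset, ν.real (f ⁻¹' {a} ∩ g ⁻¹' B a) :=
        (measureReal_mono hsub (measure_ne_top _ _)).trans (measureReal_biUnion_finset_le _ _)
    _ ≤ ∑ a ∈ A.toFinset, ν.real (f ⁻¹' {a}) * c := by
        refine Finset.sum_le_sum fun a _ => ?_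
        have hind : ν.real (f ⁻¹' {a} ∩ g ⁻¹' B a) = ν.real (f ⁻¹' {a}) * ν.real (g ⁻¹' B a) := by
          simp only [Measure.real, hfg.measure_inter_preimage_eq_mul _ _
            (MeasurableSet.of_discrete (s := {a})) (MeasurableSet.of_discrete (s := B a)),
            ENNReal.toReal_mul]
        rw [hind]
        by_cases ha : ∃ ω, f ω = a
        · obtain ⟨ω, rfl⟩ := ha
          exact mul_le_mul_of_nonneg_left (hc ω) measureReal_nonneg
        · have : f ⁻¹' {a} = ∅ := Set.eq_empty_of_forall_notMem fun ω h => ha ⟨ω, h⟩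
          simp [this]
    _ = ν.real (f ⁻¹' A) * c := by
        rw [← Finset.sum_mul,
          sum_measureReal_preimage_singleton _ fun a _ => hf MeasurableSet.of_discrete,
          Set.coe_toFinset]

variable {Ω ι : Type*} [MeasurableSpace Ω] [Fintype ι] [DecidableEq ι] {W : ι → Type*}
  [∀ i, Finite (W i)] [∀ i, MeasurableSpace (W i)] [∀ i, DiscreteMeasurableSpace (W i)]
  {M : ι → ℕ} {X : ∀ i, Fin (M i) → Ω → W i}

/-- The coordinates of the index tuple `l` that already occur, in the same coordinate, in one of
the index tuples `r k`. -/
def seenCoords {κ : Type*} [Fintype κ] (r : κ → ∀ i, Fin (M i)) (l : ∀ i, Fin (M i)) :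
    Finset ι :=
  {i | ∃ k, r k i = l i}

/-- Adding one more index tuple `l` to a family `r`: the codewords of `l` in the coordinates that
do not occur in `r` are independent of all codewords of `r`, so that the conditional probability
of typicality is governed by the set of coordinates seen before. -/
theorem measureReal_forall_and_mem_le {ν : Measure Ω} [IsFiniteMeasure ν]
    (hX : ∀ i l, Measurable (X i l))
    (hind : iIndepFun (fun x : (i : ι) × Fin (M i) => X x.1 x.2) ν) (T : Set (∀ i, W i))
    {β : Finset ι → ℝ}
    (hβ : ∀ (D : Finset ι) (l : ∀ i, Fin (M i)) (u : ∀ i, W i),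
      ν.real {ω | (fun i => if i ∈ D then u i else X i (l i) ω) ∈ T} ≤ β D)
    {κ : Type*} [Fintype κ] (r : κ → ∀ i, Fin (M i)) (l : ∀ i, Fin (M i)) :
    ν.real {ω | (∀ k, (fun i => X i (r k i) ω) ∈ T) ∧ (fun i => X i (l i) ω) ∈ T} ≤
      ν.real {ω | ∀ k, (fun i => X i (r k i) ω) ∈ T} * β (seenCoords r l) := by
  classical
  set D := seenCoords r l with hD
  let S : Finset ((i : ι) × Fin (M i)) := {x | ∃ k, r k x.1 = x.2}
  let S' : Finset ((i : ι) × Fin (M i)) := {x | l x.1 = x.2 ∧ x.1 ∉ D}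
  have hdisj : Disjoint S S' := by
    rw [Finset.disjoint_left]
    rintro x hx hx'
    simp only [S, S', Finset.mem_filter, Finset.mem_univ, true_and] at hx hx'
    obtain ⟨k, hk⟩ := hx
    exact hx'.2 (by simpa [hD, seenCoords] using ⟨k, hk.trans hx'.1.symm⟩)
  let f : Ω → ∀ x : S, W x.1.1 := fun ω x => X x.1.1 x.1.2 ω
  let g : Ω → ∀ x : S', W x.1.1 := fun ω x => X x.1.1 x.1.2 ω
  have hfg : IndepFun f g ν := hind.indepFun_finset S S' hdisj fun x => hX _ _
  have hf : Measurable f := measurable_pi_lambda _ fun x => hX _ _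
  have hfr : ∀ ω ω', f ω = f ω' → ∀ k i, X i (r k i) ω = X i (r k i) ω' := fun ω ω' h k i =>
    congrFun h ⟨⟨i, r k i⟩, by simp [S]⟩
  have hfl : ∀ ω ω', f ω = f ω' → ∀ i ∈ D, X i (l i) ω = X i (l i) ω' := by
    intro ω ω' h i hi
    simp only [hD, seenCoords, Finset.mem_filter, Finset.mem_univ, true_and] at hi
    obtain ⟨k, hk⟩ := hi
    rw [← hk]
    exact hfr ω ω' h k i
  have hgl : ∀ ω ω', g ω = g ω' → ∀ i ∉ D, X i (l i) ω = X i (l i) ω' := fun ω ω' h i hi =>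
    congrFun h ⟨⟨i, l i⟩, by simp [S', hi]⟩
  let A : Set (∀ x : S, W x.1.1) := f '' {ω | ∀ k, (fun i => X i (r k i) ω) ∈ T}
  let B : (∀ x : S, W x.1.1) → Set (∀ x : S', W x.1.1) := fun a =>
    {b | ∃ ω₁ ω₂, f ω₁ = a ∧ g ω₂ = b ∧
      (fun i => if i ∈ D then X i (l i) ω₁ else X i (l i) ω₂) ∈ T}
  have hA : f ⁻¹' A = {ω | ∀ k, (fun i => X i (r k i) ω) ∈ T} := by
    ext ω
    refine ⟨?_, fun h => ⟨ω, h, rfl⟩⟩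
    rintro ⟨ω', h', he⟩ k
    have : (fun i => X i (r k i) ω) = fun i => X i (r k i) ω' :=
      funext fun i => (hfr _ _ he k i).symm
    rw [this]
    exact h' k
  have hB : ∀ ω₀, ν.real (g ⁻¹' B (f ω₀)) ≤ β D := by
    intro ω₀
    refine (measureReal_mono ?_).trans (hβ D l fun i => X i (l i) ω₀)
    rintro ω ⟨ω₁, ω₂, h1, h2, h3⟩
    simp only [Set.mem_ofPred_eq]
    convert h3 using 2 with i
    split_ifs with hi
    · exact (hfl _ _ h1 i hi).symm
    · exact (hgl _ _ h2 i hi).symm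
  have hmain := measureReal_and_mem_le_of_indepFun hf hfg A B hB
  rw [hA] at hmain
  refine (measureReal_mono ?_).trans hmain
  rintro ω ⟨h1, h2⟩
  exact ⟨⟨ω, h1, rfl⟩, ω, ω, rfl, rfl, by simpa using h2⟩

theorem card_filter_seenCoords_eq_le {κ : Type*} [Fintype κ]
    (r : κ → ∀ i, Fin (M i)) (D : Finset ι) :
    (Finset.univ.filter fun l => seenCoords r l = D).card ≤
      Fintype.card κ ^ D.card * ∏ i ∈ Dᶜ, M i := by
  classical
  have hsub : (Finset.univ.filter fun l => seenCoords r l = D) ⊆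
      Fintype.piFinset fun i =>
        if i ∈ D then Finset.univ.image fun k => r k i else Finset.univ := by
    intro l hl
    simp only [Finset.mem_filter, Finset.mem_univ, true_and] at hl
    rw [Fintype.mem_piFinset]
    intro i
    split_ifs with hi
    · rw [← hl] at hi
      simpa [seenCoords] using hi
    · exact Finset.mem_univ _
  refine (Finset.card_le_card hsub).trans ?_
  rw [Fintype.card_piFinset, ← Finset.prod_mul_prod_compl D]
  refine Nat.mul_le_mul ?_ (le_of_eq ?_)
  · rw [← Finset.prod_const]
    refine Finset.prod_le_prod' fun i hi => ?_
    rw [if_pos hi]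
    exact Finset.card_image_le
  · refine Finset.prod_congr rfl fun i hi => ?_
    rw [if_neg (Finset.mem_compl.1 hi), Finset.card_univ, Fintype.card_fin]

/-- The bound behind the `m`-th moment of the number of typical index tuples: the expected number
of `m`-tuples of index tuples all of which are typical. -/
theorem sum_measureReal_forall_le {ν : Measure Ω} [IsProbabilityMeasure ν]
    (hX : ∀ i l, Measurable (X i l))
    (hind : iIndepFun (fun x : (i : ι) × Fin (M i) => X x.1 x.2) ν) (T : Set (∀ i, W i))
    {β : Finset ι → ℝ} (hβ0 : ∀ D, 0 ≤ β D)
    (hβ : ∀ (D : Finset ι) (l : ∀ i, Fin (M i)) (u : ∀ i, W i),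
      ν.real {ω | (fun i => if i ∈ D then u i else X i (l i) ω) ∈ T} ≤ β D)
    {n : ℕ} {B : ℝ} (hB : ∑ D, (n : ℝ) ^ D.card * (∏ i ∈ Dᶜ, (M i : ℝ)) * β D ≤ B)
    (m : ℕ) (hm : m ≤ n) :
    ∑ r : Fin m → ∀ i, Fin (M i), ν.real {ω | ∀ k, (fun i => X i (r k i) ω) ∈ T} ≤ B ^ m := by
  induction m with
  | zero => simp
  | succ m ih =>
    have ih := ih (by omega)
    have hB0 : 0 ≤ B := le_trans (Finset.sum_nonneg fun D _ => by
      have := hβ0 D; positivity) hB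
    have hcount : ∀ r : Fin m → ∀ i, Fin (M i), ∑ l, β (seenCoords r l) ≤ B := by
      intro r
      refine le_trans ?_ hB
      rw [← Finset.sum_fiberwise (s := Finset.univ) (g := fun l => seenCoords r l)]
      refine Finset.sum_le_sum fun D _ => ?_
      rw [Finset.sum_congr rfl (g := fun _ => β D) fun l hl => by
        rw [(Finset.mem_filter.1 hl).2], Finset.sum_const, nsmul_eq_mul]
      refine mul_le_mul_of_nonneg_right ?_ (hβ0 D)
      have h1 : (((Finset.univ.filter fun l => seenCoords r l = D).card : ℕ) : ℝ) ≤
          (m : ℝ) ^ D.card * ∏ i ∈ Dᶜ, (M i : ℝ) := by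
        have := card_filter_seenCoords_eq_le r D
        rw [Fintype.card_fin] at this
        exact_mod_cast this
      refine h1.trans ?_
      have hmn : (m : ℝ) ≤ n := by exact_mod_cast (by omega : m ≤ n)
      gcongr
    rw [← (Fin.snocEquiv fun _ : Fin (m + 1) => ∀ i, Fin (M i)).sum_comp,
      Fintype.sum_prod_type_right]
    calc ∑ r : Fin m → ∀ i, Fin (M i), ∑ l : ∀ i, Fin (M i), ν.real
          {ω | ∀ k, (fun i => X i ((Fin.snocEquiv fun _ : Fin (m + 1) =>
            ∀ i, Fin (M i)) (l, r) k i) ω) ∈ T}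
        ≤ ∑ r : Fin m → ∀ i, Fin (M i), ∑ l : ∀ i, Fin (M i),
          ν.real {ω | ∀ k, (fun i => X i (r k i) ω) ∈ T} * β (seenCoords r l) := by
          refine Finset.sum_le_sum fun r _ => Finset.sum_le_sum fun l _ => ?_
          refine (measureReal_mono ?_).trans (measureReal_forall_and_mem_le hX hind T hβ r l)
          intro ω hω
          refine ⟨fun k => ?_, ?_⟩
          · simpa using hω k.castSucc
          · simpa using hω (Fin.last m)
      _ ≤ ∑ r : Fin m → ∀ i, Fin (M i),
          ν.real {ω | ∀ k, (fun i => X i (r k i) ω) ∈ T} * B := by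
          refine Finset.sum_le_sum fun r _ => ?_
          rw [← Finset.mul_sum]
          exact mul_le_mul_of_nonneg_left (hcount r) measureReal_nonneg
      _ ≤ B ^ (m + 1) := by
          rw [← Finset.sum_mul, pow_succ]
          exact mul_le_mul_of_nonneg_right ih hB0

end Moments

/-! ### Empirical averages over typical sequences -/

section Typical

variable {Ω α : Type*} [MeasurableSpace Ω] {P : Measure Ω} {X : Ω → α} {ε : ℝ} {n : ℕ}

theorem measureReal_preimage_pos_of_mem_typicalSet {x : Fin n → α}
    (hx : x ∈ typicalSet P X ε n) (t : Fin n) : 0 < P.real (X ⁻¹' {x t}) := by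
  refine measureReal_nonneg.lt_of_ne fun h => ?_
  have h1 := hx (x t)
  rw [← h, mul_zero, sub_zero] at h1
  have hcard : 0 < {s | x s = x t}.ncard := (Set.ncard_pos).2 ⟨t, rfl⟩
  have hn : 0 < n := Fin.pos t
  have : (0 : ℝ) < ({s | x s = x t}.ncard : ℝ) / n := by positivity
  exact absurd h1 (not_le.2 (this.trans_le (le_abs_self _)))

/-- The typical average lemma, as a lower bound. -/
theorem le_sum_of_mem_typicalSet [Fintype α] {x : Fin n → α}
    (hx : x ∈ typicalSet P X ε n) (g : α → ℝ) :
    n * (∑ a, P.real (X ⁻¹' {a}) * g a - ε * ∑ a, P.real (X ⁻¹' {a}) * |g a|) ≤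
      ∑ t, g (x t) := by
  classical
  rcases Nat.eq_zero_or_pos n with rfl | hn
  · simp
  have hn' : (0 : ℝ) < n := by exact_mod_cast hn
  have hsum : ∑ t, g (x t) = ∑ a, ({t | x t = a}.ncard : ℝ) * g a := by
    rw [← Finset.sum_fiberwise (s := Finset.univ) (g := x)]
    refine Finset.sum_congr rfl fun a _ => ?_
    rw [Finset.sum_congr rfl (g := fun _ => g a) fun t ht => by
      rw [(Finset.mem_filter.1 ht).2], Finset.sum_const, nsmul_eq_mul]
    congr 2
    rw [← Set.ncard_coe_finset]
    simp
  rw [hsum, Finset.mul_sum, ← Finset.sum_sub_distrib, Finset.mul_sum]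
  refine Finset.sum_le_sum fun a _ => ?_
  have h1 : |({t | x t = a}.ncard : ℝ) / n - P.real (X ⁻¹' {a})| * |g a| ≤
      ε * P.real (X ⁻¹' {a}) * |g a| := mul_le_mul_of_nonneg_right (hx a) (abs_nonneg _)
  rw [← abs_mul] at h1
  have h2 := (neg_abs_le _).trans' (neg_le_neg h1)
  have h3 := mul_le_mul_of_nonneg_left h2 hn'.le
  have h4 : n * ((({t | x t = a}.ncard : ℝ) / n - P.real (X ⁻¹' {a})) * g a) =
      ({t | x t = a}.ncard : ℝ) * g a - n * (P.real (X ⁻¹' {a}) * g a) := by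
    field_simp
  rw [h4] at h3
  linarith

end Typical

/-! ### The information density of the source -/

section Source

variable {K : ℕ} {𝒬 𝒵 : Type*} {𝒱 : Fin K → Type*} {Ω : Type*} [MeasurableSpace Ω]

theorem sum_pmf_eq_one {α : Type*} [Fintype α] (p : PMF α) : ∑ x, p x = 1 := by
  rw [← tsum_fintype (L := .unconditional _), p.tsum_coe]

/-- The probability that `Q = q`, `Z = z` and `V i = v i` for all `i ∈ S`, where `a = (q, v, z)`;
the coordinates of `v` outside `S` are irrelevant. -/
noncomputable def marginalProb (P : Measure Ω) (Q : Ω → 𝒬) (V : ∀ i, Ω → 𝒱 i) (Z : Ω → 𝒵)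
    (S : Finset (Fin K)) (a : 𝒬 × (∀ i, 𝒱 i) × 𝒵) : ℝ :=
  P.real {ω | Q ω = a.1 ∧ (∀ i ∈ S, V i ω = a.2.1 i) ∧ Z ω = a.2.2}

/-- The density `log₂ (p(v_S, z | q) / (p(z | q) p(v_S | q)))` whose mean is `I(V_S; Z | Q)`. The
law of `V_S` given `Q = q` is written as the product that it is for a source of the form
`p(q) ∏ᵢ p(vᵢ | q) p(z | v)`. -/
noncomputable def infoDensity (P : Measure Ω) (pV : ∀ i, 𝒬 → PMF (𝒱 i)) (Q : Ω → 𝒬)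
    (V : ∀ i, Ω → 𝒱 i) (Z : Ω → 𝒵) (S : Finset (Fin K)) (a : 𝒬 × (∀ i, 𝒱 i) × 𝒵) : ℝ :=
  Real.logb 2 (marginalProb P Q V Z S a) - Real.logb 2 (marginalProb P Q V Z ∅ a) -
    ∑ i ∈ S, Real.logb 2 (pV i a.1 (a.2.1 i)).toReal

variable {P : Measure Ω} {pQ : PMF 𝒬} {pV : ∀ i, 𝒬 → PMF (𝒱 i)}
  {pZ : (∀ i, 𝒱 i) → PMF 𝒵} {Q : Ω → 𝒬} {V : ∀ i, Ω → 𝒱 i} {Z : Ω → 𝒵}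

theorem marginalProb_univ (a : 𝒬 × (∀ i, 𝒱 i) × 𝒵) :
    marginalProb P Q V Z Finset.univ a =
      P.real ((fun ω => (Q ω, (fun i => V i ω), Z ω)) ⁻¹' {a}) := by
  unfold marginalProb
  congr 1
  ext ω
  simp [Prod.ext_iff, funext_iff]

variable [Fintype 𝒵] [∀ i, Fintype (𝒱 i)]

theorem HasSourceLaw.measureReal_eq [IsFiniteMeasure P] (hlaw : HasSourceLaw P pQ pV pZ Q V Z)
    (hm : ∀ a, MeasurableSet ((fun ω => (Q ω, (fun i => V i ω), Z ω)) ⁻¹' {a}))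
    (S : Finset (Fin K)) (q : 𝒬) (v : ∀ i, 𝒱 i) :
    P.real {ω | Q ω = q ∧ ∀ i ∈ S, V i ω = v i} =
      (pQ q).toReal * ∏ i ∈ S, (pV i q (v i)).toReal := by
  classical
  let F : ∀ i, Finset (𝒱 i) := fun i => if i ∈ S then {v i} else Finset.univ
  have hF : ∀ w, w ∈ Fintype.piFinset F ↔ ∀ i ∈ S, w i = v i := by
    intro w
    rw [Fintype.mem_piFinset]
    refine forall_congr' fun i => ?_
    by_cases hi : i ∈ S <;> simp [F, hi]
  have hset : {ω | Q ω = q ∧ ∀ i ∈ S, V i ω = v i} =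
      ⋃ p ∈ Fintype.piFinset F ×ˢ (Finset.univ : Finset 𝒵),
        {ω | Q ω = q ∧ (∀ i, V i ω = p.1 i) ∧ Z ω = p.2} := by
    ext ω
    simp only [Set.mem_ofPred_eq, Set.mem_iUnion, Finset.mem_product, hF, Finset.mem_univ,
      and_true, exists_prop, Prod.exists]
    constructor
    · rintro ⟨h1, h2⟩
      exact ⟨fun i => V i ω, Z ω, h2, h1, fun _ => rfl, rfl⟩
    · rintro ⟨w, z, h1, h2, h3, h4⟩
      exact ⟨h2, fun i hi => (h3 i).trans (h1 i hi)⟩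
  have hmeas : P {ω | Q ω = q ∧ ∀ i ∈ S, V i ω = v i} = pQ q * ∏ i ∈ S, pV i q (v i) := by
    rw [hset, measure_biUnion_finset]
    · rw [Finset.sum_congr rfl fun p _ => hlaw q p.1 p.2]
      rw [Finset.sum_product]
      simp_rw [← Finset.mul_sum, sum_pmf_eq_one, mul_one, ← Finset.mul_sum]
      congr 1
      rw [← Finset.prod_univ_sum F fun i x => pV i q x, ← Finset.prod_mul_prod_compl S]
      have h1 : ∏ i ∈ Sᶜ, ∑ x ∈ F i, pV i q x = 1 := Finset.prod_eq_one fun i hi => by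
        simp [F, Finset.mem_compl.1 hi, sum_pmf_eq_one]
      rw [h1, mul_one]
      exact Finset.prod_congr rfl fun i hi => by simp [F, hi]
    · rintro ⟨w, z⟩ - ⟨w', z'⟩ - hne
      refine Set.disjoint_left.2 fun ω h1 h2 => hne ?_
      exact Prod.ext (funext fun i => (h1.2.1 i).symm.trans (h2.2.1 i)) (h1.2.2.symm.trans h2.2.2)
    · rintro ⟨w, z⟩ -
      convert hm (q, w, z) using 1
      ext ω
      simp [Prod.ext_iff, funext_iff]
  rw [Measure.real, hmeas, ENNReal.toReal_mul, ENNReal.toReal_prod]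

variable [Fintype 𝒬]

theorem condMutualInfo_eq_sum_infoDensity [IsFiniteMeasure P]
    (hlaw : HasSourceLaw P pQ pV pZ Q V Z)
    (hm : ∀ a, MeasurableSet ((fun ω => (Q ω, (fun i => V i ω), Z ω)) ⁻¹' {a}))
    (hV : ∀ i x, MeasurableSet (V i ⁻¹' {x})) (hQ : ∀ q, MeasurableSet (Q ⁻¹' {q}))
    (hZ : ∀ z, MeasurableSet (Z ⁻¹' {z})) (S : Finset (Fin K)) :
    condMutualInfo P (fun ω (j : S) => V j ω) Z Q =
      ∑ a, P.real ((fun ω => (Q ω, (fun i => V i ω), Z ω)) ⁻¹' {a}) *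
        infoDensity P pV Q V Z S a := by
  have hVS : ∀ x, MeasurableSet ((fun ω (j : S) => V j ω) ⁻¹' {x}) := by
    intro x
    have : (fun ω (j : S) => V j ω) ⁻¹' {x} = ⋂ j : S, V j ⁻¹' {x j} := by
      ext ω; simp [funext_iff]
    rw [this]
    exact MeasurableSet.iInter fun j => hV _ _
  unfold condMutualInfo
  rw [condEntropy_eq_integral P hVS hQ,
    condEntropy_eq_integral P hVS (measurableSet_preimage_prodMk hZ hQ)]
  have e1 := integral_comp_eq_sum P hm fun a => -Real.logb 2
    (P.real ((fun ω => ((fun j : S => V j ω), Q ω)) ⁻¹' {((fun j : S => a.2.1 j), a.1)}) /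
      P.real (Q ⁻¹' {a.1}))
  have e2 := integral_comp_eq_sum P hm fun a => -Real.logb 2
    (P.real ((fun ω => ((fun j : S => V j ω), (Z ω, Q ω))) ⁻¹'
      {((fun j : S => a.2.1 j), (a.2.2, a.1))}) /
      P.real ((fun ω => (Z ω, Q ω)) ⁻¹' {(a.2.2, a.1)}))
  rw [e1, e2, ← Finset.sum_sub_distrib]
  refine Finset.sum_congr rfl fun a _ => ?_
  rcases (measureReal_nonneg (μ := P)
    (s := (fun ω => (Q ω, (fun i => V i ω), Z ω)) ⁻¹' {a})).eq_or_lt with h0 | h0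
  · simp [← h0]
  rw [← mul_sub]
  congr 1
  have hQV : P.real ((fun ω => ((fun j : S => V j ω), Q ω)) ⁻¹'
      {((fun j : S => a.2.1 j), a.1)}) =
      (pQ a.1).toReal * ∏ i ∈ S, (pV i a.1 (a.2.1 i)).toReal := by
    rw [← hlaw.measureReal_eq hm]
    congr 1
    ext ω
    simp [Prod.ext_iff, funext_iff, and_comm]
  have hQ1 : P.real (Q ⁻¹' {a.1}) = (pQ a.1).toReal := by
    have := hlaw.measureReal_eq hm ∅ a.1 a.2.1
    simp only [Finset.prod_empty, mul_one] at this
    rw [← this]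
    congr 1
    ext ω
    simp
  have hZQ : P.real ((fun ω => (Z ω, Q ω)) ⁻¹' {(a.2.2, a.1)}) = marginalProb P Q V Z ∅ a := by
    unfold marginalProb
    congr 1
    ext ω
    simp [Prod.ext_iff, and_comm]
  have hVZQ : P.real ((fun ω => ((fun j : S => V j ω), (Z ω, Q ω))) ⁻¹'
      {((fun j : S => a.2.1 j), (a.2.2, a.1))}) = marginalProb P Q V Z S a := by
    unfold marginalProb
    congr 1
    ext ω
    simp only [Set.mem_preimage, Set.mem_singleton_iff, Prod.mk.injEq, funext_iff,
      Subtype.forall, Set.mem_ofPred_eq]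
    tauto
  have hpos : 0 < (pQ a.1).toReal * ∏ i ∈ S, (pV i a.1 (a.2.1 i)).toReal := by
    rw [← hQV]
    refine h0.trans_le (measureReal_mono fun ω h => ?_)
    simp only [Set.mem_preimage, Set.mem_singleton_iff] at h ⊢
    subst h
    rfl
  have hle : ∀ S, 0 < marginalProb P Q V Z S a := fun S =>
    h0.trans_le (measureReal_mono fun ω h => by
      simp only [Set.mem_preimage, Set.mem_singleton_iff] at h
      subst h
      exact ⟨rfl, fun _ _ => rfl, rfl⟩)
  have hq : (pQ a.1).toReal ≠ 0 := left_ne_zero_of_mul hpos.ne'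
  have hprod : ∏ i ∈ S, (pV i a.1 (a.2.1 i)).toReal ≠ 0 := right_ne_zero_of_mul hpos.ne'
  rw [hQV, hQ1, hZQ, hVZQ, mul_div_cancel_left₀ _ hq,
    Real.logb_div (hle S).ne' (hle ∅).ne', infoDensity,
    ← Real.logb_prod _ _ (Finset.prod_ne_zero_iff.1 hprod)]
  ring

/-- Packing bound: for fixed `q` and `z`, when the coordinates in `S` are prescribed by `u`, the
conditionally independent codewords in the other coordinates complete them to a typical sequence
with probability at most `2^{-n (I(V_K; Z | Q) - I(V_S; Z | Q) - ε G)}`. On a typical sequence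
`∏ₜ p(v_{Sᶜ} | q)` differs from `∏ₜ p(v_{Sᶜ} | q, v_S, z)` by that factor, and the latter weights
have sum at most one. -/
theorem sum_typical_prod_le [IsFiniteMeasure P]
    (hlaw : HasSourceLaw P pQ pV pZ Q V Z)
    (hm : ∀ a, MeasurableSet ((fun ω => (Q ω, (fun i => V i ω), Z ω)) ⁻¹' {a}))
    {ε : ℝ} {n : ℕ} (S : Finset (Fin K)) (q : Fin n → 𝒬) (z : Fin n → 𝒵)
    (u : Fin n → ∀ i, 𝒱 i) (F : Finset (Fin n → ∀ i, 𝒱 i))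
    (hFu : ∀ v ∈ F, ∀ t, ∀ i ∈ S, v t i = u t i)
    (hFT : ∀ v ∈ F, (fun t => (q t, v t, z t)) ∈
      typicalSet P (fun ω => (Q ω, (fun i => V i ω), Z ω)) ε n)
    {G : ℝ} (hG : ε * ∑ a, P.real ((fun ω => (Q ω, (fun i => V i ω), Z ω)) ⁻¹' {a}) *
      |infoDensity P pV Q V Z Finset.univ a - infoDensity P pV Q V Z S a| ≤ G) :
    ∑ v ∈ F, ∏ i ∈ Sᶜ, ∏ t, (pV i (q t) (v t i)).toReal ≤
      (2 : ℝ) ^ (-(n * (∑ a, P.real ((fun ω => (Q ω, (fun i => V i ω), Z ω)) ⁻¹' {a}) *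
        (infoDensity P pV Q V Z Finset.univ a - infoDensity P pV Q V Z S a) - G))) := by
  classical
  set g : 𝒬 × (∀ i, 𝒱 i) × 𝒵 → ℝ := fun a =>
    infoDensity P pV Q V Z Finset.univ a - infoDensity P pV Q V Z S a with hg
  set E := (n : ℝ) * (∑ a, P.real ((fun ω => (Q ω, (fun i => V i ω), Z ω)) ⁻¹' {a}) * g a - G)
    with hE
  set κ : Fin n → (∀ i, 𝒱 i) → ℝ := fun t w =>
    marginalProb P Q V Z Finset.univ (q t, w, z t) / marginalProb P Q V Z S (q t, u t, z t)
    with hκ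
  have hκ0 : ∀ t w, 0 ≤ κ t w := fun t w => div_nonneg measureReal_nonneg measureReal_nonneg
  have hterm : ∀ v ∈ F, ∏ i ∈ Sᶜ, ∏ t, (pV i (q t) (v t i)).toReal ≤
      (2 : ℝ) ^ (-E) * ∏ t, κ t (v t) := by
    intro v hv
    have hT := hFT v hv
    have hpt : ∀ t, ∏ i ∈ Sᶜ, (pV i (q t) (v t i)).toReal =
        (2 : ℝ) ^ (-g (q t, v t, z t)) * κ t (v t) := by
      intro t
      have h0 := measureReal_preimage_pos_of_mem_typicalSet hT t
      have hle : ∀ S, 0 < marginalProb P Q V Z S (q t, v t, z t) := fun S =>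
        h0.trans_le (measureReal_mono fun ω h => by
          simp only [Set.mem_preimage, Set.mem_singleton_iff, Prod.mk.injEq] at h
          exact ⟨h.1, fun i _ => congrFun h.2.1 i, h.2.2⟩)
      have hSu : marginalProb P Q V Z S (q t, u t, z t) =
          marginalProb P Q V Z S (q t, v t, z t) := by
        unfold marginalProb
        congr 1
        ext ω
        simp only [Set.mem_ofPred_eq]
        refine and_congr_right fun _ => and_congr_left fun _ => forall₂_congr fun i hi => ?_
        rw [hFu v hv t i hi]
      have hpV : ∀ i, 0 < (pV i (q t) (v t i)).toReal := by
        have h1 := hlaw.measureReal_eq hm Finset.univ (q t) (v t)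
        have h2 : 0 < P.real {ω | Q ω = q t ∧ ∀ i ∈ Finset.univ, V i ω = v t i} :=
          (hle Finset.univ).trans_le (measureReal_mono fun ω h => ⟨h.1, h.2.1⟩)
        rw [h1] at h2
        intro i
        exact ENNReal.toReal_nonneg.lt_of_ne'
          (Finset.prod_ne_zero_iff.1 (right_ne_zero_of_mul h2.ne') i (Finset.mem_univ i))
      have hprod : 0 < ∏ i ∈ Sᶜ, (pV i (q t) (v t i)).toReal :=
        Finset.prod_pos fun i _ => hpV i
      have hlog : -g (q t, v t, z t) =
          Real.logb 2 ((∏ i ∈ Sᶜ, (pV i (q t) (v t i)).toReal) *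
            marginalProb P Q V Z S (q t, v t, z t) /
              marginalProb P Q V Z Finset.univ (q t, v t, z t)) := by
        rw [Real.logb_div (mul_pos hprod (hle S)).ne' (hle _).ne',
          Real.logb_mul hprod.ne' (hle S).ne', Real.logb_prod _ _ fun i _ => (hpV i).ne']
        simp only [hg, infoDensity]
        rw [← Finset.sum_add_sum_compl S]
        ring
      have := hle S
      have := hle Finset.univ
      rw [hlog, Real.rpow_logb two_pos (by norm_num) (by positivity), hκ]
      simp only [hSu]
      field_simp
    rw [Finset.prod_comm, Finset.prod_congr rfl fun t _ => hpt t, Finset.prod_mul_distrib,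
      ← Real.rpow_sum_of_pos two_pos]
    refine mul_le_mul_of_nonneg_right ?_ (Finset.prod_nonneg fun t _ => hκ0 t _)
    refine Real.rpow_le_rpow_of_exponent_le one_le_two ?_
    rw [Finset.sum_neg_distrib, neg_le_neg_iff, hE]
    refine le_trans ?_ (le_sum_of_mem_typicalSet hT g)
    gcongr
  refine (Finset.sum_le_sum hterm).trans ?_
  rw [← Finset.mul_sum]
  refine mul_le_of_le_one_right (by positivity) ?_
  let A : Fin n → Finset (∀ i, 𝒱 i) := fun t => {w | ∀ i ∈ S, w i = u t i}
  have hFA : F ⊆ Fintype.piFinset A := fun v hv => by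
    simpa [A] using hFu v hv
  refine (Finset.sum_le_sum_of_subset_of_nonneg hFA fun v _ _ =>
    Finset.prod_nonneg fun t _ => hκ0 t _).trans ?_
  rw [← Finset.prod_univ_sum A κ]
  refine Finset.prod_le_one (fun t _ => Finset.sum_nonneg fun w _ => hκ0 t w) fun t _ => ?_
  have hsum : ∑ w ∈ A t, marginalProb P Q V Z Finset.univ (q t, w, z t) ≤
      marginalProb P Q V Z S (q t, u t, z t) := by
    simp_rw [marginalProb_univ]
    rw [← measureReal_biUnion_finset]
    · refine measureReal_mono ?_
      intro ω hω
      simp only [Set.mem_iUnion, Set.mem_preimage, Set.mem_singleton_iff, Prod.mk.injEq] at hω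
      obtain ⟨w, hw, h1, h2, h3⟩ := hω
      refine ⟨h1, fun i hi => ?_, h3⟩
      simp only [A, Finset.mem_filter, Finset.mem_univ, true_and] at hw
      exact (congrFun h2 i).trans (hw i hi)
    · intro w _ w' _ hne
      refine Set.disjoint_left.2 fun ω h1 h2 => hne ?_
      simp only [Set.mem_preimage, Set.mem_singleton_iff, Prod.mk.injEq] at h1 h2
      exact h1.2.1.symm.trans h2.2.1
    · exact fun w _ => hm _
  simp only [hκ]
  rw [← Finset.sum_div]
  exact div_le_one_of_le₀ hsum measureReal_nonneg

end Source

/-! ### Equivocation and moments of the list size -/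

section ListSize

variable {Ω : Type*} [MeasurableSpace Ω]

theorem integral_ncard_pow {ι : Type*} [Fintype ι] (μ : Measure Ω) [IsFiniteMeasure μ]
    {E : ι → Set Ω} (hE : ∀ l, MeasurableSet (E l)) (m : ℕ) :
    ∫ ω, ({l | ω ∈ E l}.ncard : ℝ) ^ m ∂μ =
      ∑ r : Fin m → ι, μ.real {ω | ∀ k, ω ∈ E (r k)} := by
  classical
  have hset : ∀ r : Fin m → ι, MeasurableSet {ω | ∀ k, ω ∈ E (r k)} := by
    intro r
    have : {ω | ∀ k, ω ∈ E (r k)} = ⋂ k, E (r k) := by ext ω; simp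
    rw [this]
    exact MeasurableSet.iInter fun k => hE _
  have hpow : ∀ ω, ({l | ω ∈ E l}.ncard : ℝ) ^ m =
      ∑ r : Fin m → ι, Set.indicator {ω | ∀ k, ω ∈ E (r k)} (fun _ => (1 : ℝ)) ω := by
    intro ω
    have h1 : ({l | ω ∈ E l}.ncard : ℝ) = ∑ l, if ω ∈ E l then (1 : ℝ) else 0 := by
      rw [Finset.sum_boole, ← Set.ncard_coe_finset]
      simp
    rw [h1, Fintype.sum_pow]
    refine Finset.sum_congr rfl fun r _ => ?_
    rw [Finset.prod_ite_zero]
    simp [Set.indicator_apply]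
  simp_rw [hpow]
  rw [integral_finsetSum _ fun r _ => (integrable_const _).indicator (hset r)]
  refine Finset.sum_congr rfl fun r _ => ?_
  rw [integral_indicator_const _ (hset r), smul_eq_mul, mul_one]

/-- If `T` is a relation such that, up to a small probability, `L` is in the list `{l | T l Y}`,
then `H(L | Y)` is at most about the logarithm of the list size, which may be measured by
its `m`-th moment. Given `Y = y`, the index is described by one bit telling whether it is in the
list, followed by its uniform description in the list or in the whole alphabet. -/
theorem condEntropy_le_of_integral_ncard_pow_le {Λ β : Type*} [Fintype Λ] [Fintype β]
    (μ : Measure Ω) [IsProbabilityMeasure μ] {L : Ω → Λ} {Y : Ω → β}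
    (hL : ∀ x, MeasurableSet (L ⁻¹' {x})) (hY : ∀ y, MeasurableSet (Y ⁻¹' {y}))
    (T : Λ → β → Prop) {s B : ℝ} (hs : (Fintype.card Λ : ℝ) ≤ 2 ^ s) (hB : 1 ≤ B) {m : ℕ} (hm : 0 < m)
    (hmom : ∫ ω, ({l | T l (Y ω)}.ncard : ℝ) ^ m ∂μ ≤ B ^ m) :
    condEntropy μ L Y ≤
      1 + s * (1 - μ.real {ω | T (L ω) (Y ω)}) + Real.logb 2 B + 2 / m := by
  classical
  rcases isEmpty_or_nonempty Λ with hΛ | hΛ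
  · have : IsEmpty Ω := ⟨fun ω => hΛ.false (L ω)⟩
    have h := measure_univ (μ := μ)
    rw [Set.eq_empty_of_isEmpty Set.univ, measure_empty] at h
    exact absurd h zero_ne_one
  have hcard : (0 : ℝ) < Fintype.card Λ := by exact_mod_cast Fintype.card_pos
  have hB0 : 0 < B := by linarith
  have hm' : (0 : ℝ) < m := by exact_mod_cast hm
  let N : β → ℝ := fun y => ({l | T l y}.ncard : ℝ)
  have hN : ∀ l y, T l y → 1 ≤ N y := by
    intro l y h
    have : 0 < {l | T l y}.ncard := (Set.ncard_pos).2 ⟨l, h⟩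
    exact Nat.one_le_cast.2 this
  let r : Λ → β → ℝ := fun l y => if T l y then 1 / (2 * N y) else 1 / (2 * Fintype.card Λ)
  have hr : ∀ l y, 0 < r l y := by
    intro l y
    by_cases h : T l y
    · have := hN l y h
      simp only [r, if_pos h]
      positivity
    · simp only [r, if_neg h]
      positivity
  have hr1 : ∀ y, ∑ l, r l y ≤ 1 := by
    intro y
    have hsplit : ∑ l, r l y = N y * (1 / (2 * N y)) +
        ((Finset.univ.filter fun l => ¬ T l y).card : ℝ) * (1 / (2 * Fintype.card Λ)) := by
      simp only [r]
      rw [Finset.sum_ite, Finset.sum_const, Finset.sum_const, nsmul_eq_mul, nsmul_eq_mul]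
      congr 2
      simp only [N]
      rw [← Set.ncard_coe_finset]
      simp
    have h1 : N y * (1 / (2 * N y)) ≤ 1 / 2 := by
      rcases eq_or_ne (N y) 0 with h | h
      · rw [h]; norm_num
      · apply le_of_eq; field_simp
    have h2 : ((Finset.univ.filter fun l => ¬ T l y).card : ℝ) * (1 / (2 * Fintype.card Λ)) ≤
        1 / 2 := by
      have : ((Finset.univ.filter fun l => ¬ T l y).card : ℝ) ≤ Fintype.card Λ := by
        exact_mod_cast Finset.card_le_univ _
      calc _ ≤ (Fintype.card Λ : ℝ) * (1 / (2 * Fintype.card Λ)) := by gcongr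
        _ = 1 / 2 := by field_simp
    linarith
  have hlogB : 0 ≤ Real.logb 2 B := Real.logb_nonneg one_lt_two hB
  have hcost : ∀ l y, -Real.logb 2 (r l y) ≤
      1 + s * (if T l y then 0 else 1) + Real.logb 2 B + 2 / m * (N y ^ m / B ^ m) := by
    intro l y
    have hNy : 0 ≤ N y := Nat.cast_nonneg _
    by_cases h : T l y
    · have h1 := hN l y h
      simp only [r, if_pos h, one_div, Real.logb_inv, neg_neg, mul_zero, add_zero]
      rw [Real.logb_mul two_ne_zero (by linarith), Real.logb_self_eq_one one_lt_two]
      set x := N y / B with hx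
      have hx0 : 0 < x := by positivity
      have hNx : N y = B * x := by rw [hx]; field_simp
      have h2 : m * Real.log x ≤ x ^ m := by
        rw [← Real.log_pow]
        exact (Real.log_le_sub_one_of_pos (by positivity)).trans (by linarith)
      have hl2 : 1 / 2 < Real.log 2 := by linarith [Real.log_two_gt_d9]
      have h3 : Real.logb 2 x ≤ 2 / m * x ^ m := by
        rw [Real.logb, div_le_iff₀ (by linarith), div_mul_eq_mul_div, div_mul_eq_mul_div,
          le_div_iff₀ hm']
        have : 0 ≤ x ^ m := by positivity
        nlinarith
      rw [hNx, Real.logb_mul hB0.ne' hx0.ne', mul_pow, mul_div_cancel_left₀ _ (by positivity)]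
      linarith
    · simp only [r, if_neg h, one_div, Real.logb_inv, neg_neg, mul_one]
      rw [Real.logb_mul two_ne_zero hcard.ne', Real.logb_self_eq_one one_lt_two]
      have h1 : Real.logb 2 (Fintype.card Λ) ≤ s := by
        rw [Real.logb_le_iff_le_rpow one_lt_two hcard]
        exact hs
      have : 0 ≤ 2 / (m : ℝ) * (N y ^ m / B ^ m) := by positivity
      linarith
  refine (condEntropy_le_integral μ hL hY hr hr1).trans ?_
  have hLY := measurableSet_preimage_prodMk hL hY
  have hintT := integrable_comp_of_fintype μ hLY fun p => if T p.1 p.2 then (0 : ℝ) else 1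
  have hintN := integrable_comp_of_fintype μ hY fun y => N y ^ m / B ^ m
  have hT : MeasurableSet {ω | T (L ω) (Y ω)} := by
    have : {ω | T (L ω) (Y ω)} =
        ⋃ p ∈ {p : Λ × β | T p.1 p.2}, (fun ω => (L ω, Y ω)) ⁻¹' {p} := by
      ext ω; simp
    rw [this]
    exact MeasurableSet.biUnion (Set.to_countable _) fun p _ => hLY p
  have hind : ∫ ω, (if T (L ω) (Y ω) then (0 : ℝ) else 1) ∂μ =
      1 - μ.real {ω | T (L ω) (Y ω)} := by
    rw [← probReal_compl_eq_one_sub hT, ← integral_indicator_one hT.compl]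
    refine integral_congr_ae (.of_forall fun ω => ?_)
    by_cases h : T (L ω) (Y ω) <;> simp [h]
  have hle := integral_mono (integrable_comp_of_fintype μ hLY fun p => -Real.logb 2 (r p.1 p.2))
    ((((integrable_const 1).add (hintT.const_mul s)).add
      (integrable_const (Real.logb 2 B))).add (hintN.const_mul (2 / (m : ℝ))))
    fun ω => hcost (L ω) (Y ω)
  refine hle.trans (le_of_eq_of_le
    (integral_add (((integrable_const 1).add (hintT.const_mul s)).add
      (integrable_const (Real.logb 2 B))) (hintN.const_mul (2 / (m : ℝ)))) ?_)
  rw [integral_add' ((integrable_const 1).add (hintT.const_mul s)) (integrable_const _),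
    integral_add' (integrable_const 1) (hintT.const_mul s), integral_const_mul,
    integral_const_mul, integral_div]
  simp only [integral_const, probReal_univ, one_smul]
  have hq : (∫ ω, N (Y ω) ^ m ∂μ) / B ^ m ≤ 1 := div_le_one_of_le₀ hmom (by positivity)
  have : 2 / (m : ℝ) * ((∫ ω, N (Y ω) ^ m ∂μ) / B ^ m) ≤ 2 / m :=
    mul_le_of_le_one_right (by positivity) hq
  rw [hind]
  linarith

end ListSize

/-! ### The random codebook -/

section Codebook

variable {K : ℕ} {𝒬 𝒵 : Type*} {𝒱 : Fin K → Type*} [MeasurableSpace 𝒬]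
    [∀ i, MeasurableSpace (𝒱 i)] {pQ : PMF 𝒬} {pV : ∀ i, 𝒬 → PMF (𝒱 i)}
    {Ω : Type*} [MeasurableSpace Ω] {μ : Measure Ω}

theorem IsRandomCodebook.measurable_codebook {n : ℕ} {M : Fin K → ℕ} {Qn : Ω → Fin n → 𝒬}
    {Vn : ∀ i, Fin (M i) → Ω → Fin n → 𝒱 i} (h : IsRandomCodebook μ pQ pV Qn Vn) :
    Measurable (codebook Qn Vn) :=
  h.measurable_Q.prodMk (measurable_pi_lambda _ fun i => measurable_pi_lambda _ fun l =>
    h.measurable_V i l)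

variable [Fintype 𝒬] [∀ i, Fintype (𝒱 i)] [∀ i, DiscreteMeasurableSpace (𝒱 i)]
    [IsProbabilityMeasure μ]

/-- The joint packing bound, for the codewords indexed by `l` in the coordinates outside `D`. -/
theorem IsRandomCodebook.measureReal_typical_le [Fintype 𝒵] {Ω₀ : Type*} [MeasurableSpace Ω₀]
    {P : Measure Ω₀} [IsProbabilityMeasure P] {pZ : (∀ i, 𝒱 i) → PMF 𝒵}
    {Q : Ω₀ → 𝒬} {V : ∀ i, Ω₀ → 𝒱 i} {Z : Ω₀ → 𝒵} (hlaw : HasSourceLaw P pQ pV pZ Q V Z)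
    (hm : ∀ a, MeasurableSet ((fun ω => (Q ω, (fun i => V i ω), Z ω)) ⁻¹' {a}))
    {n : ℕ} {M : Fin K → ℕ} {Qn : Ω → Fin n → 𝒬}
    {Vn : ∀ i, Fin (M i) → Ω → Fin n → 𝒱 i} (hcb : IsRandomCodebook μ pQ pV Qn Vn)
    (q : Fin n → 𝒬) (hq : μ (Qn ⁻¹' {q}) ≠ 0) (z : Fin n → 𝒵) {ε : ℝ}
    (D : Finset (Fin K)) (l : ∀ i, Fin (M i)) (u : ∀ i, Fin n → 𝒱 i)
    {G : ℝ} (hG : ε * ∑ a, P.real ((fun ω => (Q ω, (fun i => V i ω), Z ω)) ⁻¹' {a}) *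
      |infoDensity P pV Q V Z Finset.univ a - infoDensity P pV Q V Z D a| ≤ G) :
    (μ[|Qn ⁻¹' {q}]).real {ω | (fun i => if i ∈ D then u i else Vn i (l i) ω) ∈
      {w : ∀ i, Fin n → 𝒱 i | (fun t => (q t, (fun i => w i t), z t)) ∈
        typicalSet P (fun ω => (Q ω, (fun i => V i ω), Z ω)) ε n}} ≤
      (2 : ℝ) ^ (-(n * (∑ a, P.real ((fun ω => (Q ω, (fun i => V i ω), Z ω)) ⁻¹' {a}) *
        (infoDensity P pV Q V Z Finset.univ a - infoDensity P pV Q V Z D a) - G))) := by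
  classical
  have := cond_isProbabilityMeasure hq
  set ν := μ[|Qn ⁻¹' {q}]
  let F : Finset (Fin n → ∀ i, 𝒱 i) := {v | (∀ t, ∀ i ∈ D, v t i = u i t) ∧
    (fun t => (q t, v t, z t)) ∈ typicalSet P (fun ω => (Q ω, (fun i => V i ω), Z ω)) ε n}
  have hF : ∀ v ∈ F, (∀ t, ∀ i ∈ D, v t i = u i t) ∧ (fun t => (q t, v t, z t)) ∈
      typicalSet P (fun ω => (Q ω, (fun i => V i ω), Z ω)) ε n := fun v hv => by
    simpa [F] using hv
  refine le_trans ?_ (sum_typical_prod_le hlaw hm D q z (fun t i => u i t) F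
    (fun v hv => (hF v hv).1) (fun v hv => (hF v hv).2) hG)
  have hsub : {ω | (fun i => if i ∈ D then u i else Vn i (l i) ω) ∈
      {w : ∀ i, Fin n → 𝒱 i | (fun t => (q t, (fun i => w i t), z t)) ∈
        typicalSet P (fun ω => (Q ω, (fun i => V i ω), Z ω)) ε n}} ⊆
      ⋃ v ∈ F, ⋂ i ∈ Dᶜ, Vn i (l i) ⁻¹' {fun t => v t i} := by
    intro ω hω
    simp only [Set.mem_iUnion, exists_prop]
    refine ⟨fun t i => (if i ∈ D then u i else Vn i (l i) ω) t, ?_, ?_⟩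
    · simp only [F, Finset.mem_filter, Finset.mem_univ, true_and]
      exact ⟨fun t i hi => by rw [if_pos hi], hω⟩
    · simp only [Set.mem_iInter, Set.mem_preimage, Set.mem_singleton_iff]
      intro i hi
      simp [Finset.mem_compl.1 hi]
  refine (measureReal_mono hsub (measure_ne_top _ _)).trans
    ((measureReal_biUnion_finset_le _ _).trans (Finset.sum_le_sum fun v _ => le_of_eq ?_))
  have hinj : Function.Injective fun i : Fin K => (⟨i, l i⟩ : (i : Fin K) × Fin (M i)) :=
    fun i j h => congrArg Sigma.fst h
  have hind := (hcb.condIndep q hq).precomp hinj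
  have h1 := hind.measure_inter_preimage_eq_mul Dᶜ (sets := fun i => {fun t => v t i})
    fun i _ => measurableSet_singleton _
  rw [Measure.real, h1, ENNReal.toReal_prod]
  refine Finset.prod_congr rfl fun i _ => ?_
  rw [hcb.law_V q hq i (l i), ENNReal.toReal_prod]

/-- The number of codeword tuples in all coordinate patterns, weighted by the packing bounds. The
rate constraint for the set `D` of coordinates seen before makes each pattern contribute at most
what the pattern `D = ∅` does. -/
theorem sum_card_mul_packing_le {ι : Type*} [Fintype ι] [DecidableEq ι] {n : ℕ} (hn : 0 < n)
    {R : ι → ℝ} {I : Finset ι → ℝ} (hrate : ∀ J, I J ≤ ∑ j ∈ J, R j) (G : ℝ) :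
    ∑ D : Finset ι, (n : ℝ) ^ D.card * (∏ i ∈ Dᶜ, (numIdx n (R i) : ℝ)) *
      (2 : ℝ) ^ (-(n * (I Finset.univ - I D - G))) ≤
      (2 * n : ℝ) ^ Fintype.card ι * 2 ^ (n * (∑ j, R j - I Finset.univ + G)) := by
  let β : Finset ι → ℝ := fun D => (2 : ℝ) ^ (-(n * (I Finset.univ - I D - G)))
  have hβ0 : ∀ D, 0 ≤ β D := fun D => by positivity
  have hn1 : (1 : ℝ) ≤ n := by exact_mod_cast hn
  have hterm : ∀ D : Finset ι,
      (n : ℝ) ^ D.card * (∏ i ∈ Dᶜ, (numIdx n (R i) : ℝ)) * β D ≤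
        (n : ℝ) ^ Fintype.card ι * 2 ^ (n * (∑ j, R j - I Finset.univ + G)) := by
    intro D
    have h1 : (n : ℝ) ^ D.card ≤ (n : ℝ) ^ Fintype.card ι :=
      pow_le_pow_right₀ hn1 D.card_le_univ
    have h2 : ∏ i ∈ Dᶜ, (numIdx n (R i) : ℝ) ≤ 2 ^ (n * ∑ i ∈ Dᶜ, R i) := by
      rw [Finset.mul_sum, Real.rpow_sum_of_pos two_pos]
      exact Finset.prod_le_prod (fun i _ => Nat.cast_nonneg _) fun i _ =>
        Nat.floor_le (by positivity)
    have h3 : (2 : ℝ) ^ (n * ∑ i ∈ Dᶜ, R i) * β D ≤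
        2 ^ (n * (∑ j, R j - I Finset.univ + G)) := by
      rw [← Real.rpow_add two_pos]
      refine Real.rpow_le_rpow_of_exponent_le one_le_two ?_
      have h4 := hrate D
      rw [← Finset.sum_add_sum_compl D]
      have h5 : 0 ≤ n * (∑ j ∈ D, R j - I D) := mul_nonneg (by positivity) (sub_nonneg.2 h4)
      linarith
    rw [mul_assoc]
    exact mul_le_mul h1 ((mul_le_mul_of_nonneg_right h2 (hβ0 D)).trans h3)
      (mul_nonneg (by positivity) (hβ0 D)) (by positivity)
  refine (Finset.sum_le_sum fun D _ => hterm D).trans (le_of_eq ?_)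
  rw [Finset.sum_const, Finset.card_univ, Fintype.card_finset, nsmul_eq_mul, mul_pow]
  push_cast
  ring

/-- The expected `m`-th power of the number of index tuples whose codewords lie in `T` together
with a fixed `z`, in terms of bounds `β D` on the probability that the codewords in the
coordinates outside `D` complete prescribed codewords in `D` to an element of `T`. -/
theorem IsRandomCodebook.integral_ncard_pow_le [DiscreteMeasurableSpace 𝒬] {n : ℕ} {M : Fin K → ℕ} {Qn : Ω → Fin n → 𝒬}
    {Vn : ∀ i, Fin (M i) → Ω → Fin n → 𝒱 i} (hcb : IsRandomCodebook μ pQ pV Qn Vn)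
    (z : Fin n → 𝒵) (T : Set (Fin n → 𝒬 × (∀ i, 𝒱 i) × 𝒵)) {β : Finset (Fin K) → ℝ}
    (hβ0 : ∀ D, 0 ≤ β D)
    (hβ : ∀ q : Fin n → 𝒬, μ (Qn ⁻¹' {q}) ≠ 0 → ∀ (D : Finset (Fin K)) (l : ∀ i, Fin (M i))
      (u : ∀ i, Fin n → 𝒱 i),
      (μ[|Qn ⁻¹' {q}]).real {ω | (fun i => if i ∈ D then u i else Vn i (l i) ω) ∈
        {w : ∀ i, Fin n → 𝒱 i | (fun t => (q t, (fun i => w i t), z t)) ∈ T}} ≤ β D)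
    {B : ℝ} (hsum : ∑ D, (n : ℝ) ^ D.card * (∏ i ∈ Dᶜ, (M i : ℝ)) * β D ≤ B) {m : ℕ} (hmn : m ≤ n) :
    ∫ ω, ({l : ∀ i, Fin (M i) |
      (fun t => ((codebook Qn Vn ω).1 t, (fun i => (codebook Qn Vn ω).2 i (l i) t), z t)) ∈
        T}.ncard : ℝ) ^ m ∂μ ≤ B ^ m := by
  classical
  have hcond : ∀ q : Fin n → 𝒬, μ (Qn ⁻¹' {q}) ≠ 0 →
      ∑ r : Fin m → ∀ i, Fin (M i), (μ[|Qn ⁻¹' {q}]).real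
        {ω | ∀ k, (fun i => Vn i (r k i) ω) ∈
          {w : ∀ i, Fin n → 𝒱 i | (fun t => (q t, (fun i => w i t), z t)) ∈ T}} ≤ B ^ m := by
    intro q hq
    have := cond_isProbabilityMeasure hq
    exact sum_measureReal_forall_le hcb.measurable_V (hcb.condIndep q hq) _ hβ0 (hβ q hq) hsum m hmn
  have hQ : ∀ q, MeasurableSet (Qn ⁻¹' {q}) := fun q =>
    hcb.measurable_Q (measurableSet_singleton q)
  have hE : ∀ l : ∀ i, Fin (M i), MeasurableSet {ω |
      (fun t => ((codebook Qn Vn ω).1 t, (fun i => (codebook Qn Vn ω).2 i (l i) t), z t)) ∈ T} :=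
    fun l => hcb.measurable_codebook (MeasurableSet.of_discrete
      (s := {c : (Fin n → 𝒬) × (∀ i, Fin (M i) → Fin n → 𝒱 i) |
        (fun t => (c.1 t, (fun i => c.2 i (l i) t), z t)) ∈ T}))
  refine le_of_eq_of_le (integral_ncard_pow μ hE m) ?_
  have hsplit : ∀ r : Fin m → ∀ i, Fin (M i),
      μ.real {ω | ∀ k, ω ∈ {ω | (fun t => ((codebook Qn Vn ω).1 t,
        (fun i => (codebook Qn Vn ω).2 i (r k i) t), z t)) ∈ T}} ≤
      ∑ q : Fin n → 𝒬, μ.real (Qn ⁻¹' {q}) * (μ[|Qn ⁻¹' {q}]).real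
        {ω | ∀ k, (fun i => Vn i (r k i) ω) ∈
          {w : ∀ i, Fin n → 𝒱 i | (fun t => (q t, (fun i => w i t), z t)) ∈ T}} := by
    intro r
    have hle : ∀ q : Fin n → 𝒬, μ.real (Qn ⁻¹' {q} ∩ {ω | ∀ k, (fun i => Vn i (r k i) ω) ∈
        {w : ∀ i, Fin n → 𝒱 i | (fun t => (q t, (fun i => w i t), z t)) ∈ T}}) =
        μ.real (Qn ⁻¹' {q}) * (μ[|Qn ⁻¹' {q}]).real
        {ω | ∀ k, (fun i => Vn i (r k i) ω) ∈
          {w : ∀ i, Fin n → 𝒱 i | (fun t => (q t, (fun i => w i t), z t)) ∈ T}} := by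
      intro q
      rw [Measure.real, ← cond_mul_eq_inter (hQ q), ENNReal.toReal_mul, mul_comm]
      rfl
    simp_rw [← hle]
    refine (measureReal_mono ?_ (measure_ne_top _ _)).trans (measureReal_biUnion_finset_le _ _)
    intro ω hω
    simp only [Set.mem_iUnion]
    exact ⟨Qn ω, Finset.mem_univ _, rfl, hω⟩
  refine (Finset.sum_le_sum fun r _ => hsplit r).trans ?_
  rw [Finset.sum_comm]
  have hone : ∑ q : Fin n → 𝒬, μ.real (Qn ⁻¹' {q}) = 1 := by
    rw [sum_measureReal_preimage_singleton _ fun q _ => hQ q]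
    simp
  calc _ ≤ ∑ q : Fin n → 𝒬, μ.real (Qn ⁻¹' {q}) * B ^ m := by
        refine Finset.sum_le_sum fun q _ => ?_
        rw [← Finset.mul_sum]
        rcases eq_or_ne (μ (Qn ⁻¹' {q})) 0 with h | h
        · simp [Measure.real, h]
        · exact mul_le_mul_of_nonneg_left (hcond q h) measureReal_nonneg
    _ = B ^ m := by rw [← Finset.sum_mul, hone, one_mul]

end Codebook

/-! ### The bound on the equivocation -/

theorem tendsto_mul_add_logb_div_atTop (a b c : ℝ) :
    Tendsto (fun x : ℕ × ℝ => x.2 * a + (b + c * Real.logb 2 (2 * x.1)) / x.1)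
      (atTop ×ˢ 𝓝[>] (0 : ℝ)) (𝓝 0) := by
  have h1 : Tendsto (fun x : ℕ × ℝ => x.2 * a) (atTop ×ˢ 𝓝[>] (0 : ℝ)) (𝓝 (0 * a)) :=
    ((tendsto_nhdsWithin_of_tendsto_nhds tendsto_id).comp tendsto_snd).mul_const a
  have h2 : Tendsto (fun y : ℝ => Real.log y / y) atTop (𝓝 0) :=
    Real.isLittleO_log_id_atTop.tendsto_div_nhds_zero
  have h3 : Tendsto (fun n : ℕ => 2 * (n : ℝ)) atTop atTop :=
    tendsto_natCast_atTop_atTop.const_mul_atTop two_pos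
  have h4 : Tendsto (fun n : ℕ => b / (n : ℝ) +
      c * (2 / Real.log 2) * (Real.log (2 * (n : ℝ)) / (2 * (n : ℝ)))) atTop
      (𝓝 (0 + c * (2 / Real.log 2) * 0)) :=
    (tendsto_const_div_atTop_nhds_zero_nat b).add ((h2.comp h3).const_mul _)
  have h5 := h1.add (h4.comp tendsto_fst)
  simp only [zero_mul, mul_zero, add_zero] at h5
  refine h5.congr fun x => ?_
  simp only [Function.comp, Real.logb]
  rcases eq_or_ne (x.1 : ℝ) 0 with h | h
  · simp [h]
  · have : Real.log 2 ≠ 0 := (Real.log_pos one_lt_two).ne'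
    field_simp

section Main

variable {K : ℕ} {𝒬 𝒵 : Type*} {𝒱 : Fin K → Type*}
    [Fintype 𝒬] [MeasurableSpace 𝒬] [DiscreteMeasurableSpace 𝒬]
    [Fintype 𝒵] [MeasurableSpace 𝒵] [DiscreteMeasurableSpace 𝒵]
    [∀ i, Fintype (𝒱 i)] [∀ i, MeasurableSpace (𝒱 i)] [∀ i, DiscreteMeasurableSpace (𝒱 i)]
    {pQ : PMF 𝒬} {pV : ∀ i, 𝒬 → PMF (𝒱 i)} {Ω : Type*} [MeasurableSpace Ω] {μ : Measure Ω}
    [IsProbabilityMeasure μ]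

/-- `Z^n` may depend on the codebook. Bounding the `m`-th power of the list size at `Z^n` by its
sum over all `z` costs the number of sequences `z`, that is, a factor `|𝒵|^n`. -/
theorem IsRandomCodebook.integral_ncard_pow_le_of_dependent {n : ℕ} {M : Fin K → ℕ}
    {Qn : Ω → Fin n → 𝒬} {Vn : ∀ i, Fin (M i) → Ω → Fin n → 𝒱 i}
    (hcb : IsRandomCodebook μ pQ pV Qn Vn) {Zn : Ω → Fin n → 𝒵} (hZn : Measurable Zn)
    (T : Set (Fin n → 𝒬 × (∀ i, 𝒱 i) × 𝒵)) {m : ℕ} {B : ℝ}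
    (hmom : ∀ z : Fin n → 𝒵, ∫ ω, ({l : ∀ i, Fin (M i) |
      (fun t => ((codebook Qn Vn ω).1 t, (fun i => (codebook Qn Vn ω).2 i (l i) t), z t)) ∈
        T}.ncard : ℝ) ^ m ∂μ ≤ B) :
    ∫ ω, ({l : ∀ i, Fin (M i) | (fun t => ((codebook Qn Vn ω).1 t,
      (fun i => (codebook Qn Vn ω).2 i (l i) t), Zn ω t)) ∈ T}.ncard : ℝ) ^ m ∂μ ≤
      (Fintype.card 𝒵 : ℝ) ^ n * B := by
  classical
  let N : (Fin n → 𝒵) → (Fin n → 𝒬) × (∀ i, Fin (M i) → Fin n → 𝒱 i) → ℝ := fun z c =>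
    ({l : ∀ i, Fin (M i) |
      (fun t => (c.1 t, (fun i => c.2 i (l i) t), z t)) ∈ T}.ncard : ℝ) ^ m
  have hN : ∀ z c, 0 ≤ N z c := fun z c => by positivity
  have hC : ∀ c, MeasurableSet (codebook Qn Vn ⁻¹' {c}) := fun c =>
    hcb.measurable_codebook (measurableSet_singleton c)
  have hint : ∀ z, Integrable (fun ω => N z (codebook Qn Vn ω)) μ := fun z =>
    integrable_comp_of_fintype μ hC (N z)
  have hintZ : Integrable (fun ω => N (Zn ω) (codebook Qn Vn ω)) μ :=
    integrable_comp_of_fintype μ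
      (measurableSet_preimage_prodMk (fun z => hZn (measurableSet_singleton z)) hC)
      fun p => N p.1 p.2
  calc ∫ ω, N (Zn ω) (codebook Qn Vn ω) ∂μ
      ≤ ∫ ω, ∑ z, N z (codebook Qn Vn ω) ∂μ :=
        integral_mono hintZ (integrable_finsetSum _ fun z _ => hint z) fun ω =>
          Finset.single_le_sum (f := fun z => N z (codebook Qn Vn ω)) (fun z _ => hN z _)
            (Finset.mem_univ (Zn ω))
    _ = ∑ z, ∫ ω, N z (codebook Qn Vn ω) ∂μ := integral_finsetSum _ fun z _ => hint z
    _ ≤ ∑ _z : Fin n → 𝒵, B := Finset.sum_le_sum fun z _ => hmom z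
    _ = (Fintype.card 𝒵 : ℝ) ^ n * B := by simp

/-- The bound at a fixed blocklength. The moment of order `n` is used, for which passing to the
worst `z` multiplies the list size by `|𝒵|` only. -/
theorem IsRandomCodebook.condEntropy_le [Nonempty 𝒵] {Ω₀ : Type*} [MeasurableSpace Ω₀]
    {P : Measure Ω₀} [IsProbabilityMeasure P] {pZ : (∀ i, 𝒱 i) → PMF 𝒵}
    {Q : Ω₀ → 𝒬} {V : ∀ i, Ω₀ → 𝒱 i} {Z : Ω₀ → 𝒵} (hlaw : HasSourceLaw P pQ pV pZ Q V Z)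
    (hm : ∀ a, MeasurableSet ((fun ω => (Q ω, (fun i => V i ω), Z ω)) ⁻¹' {a}))
    {R : Fin K → ℝ} {I : Finset (Fin K) → ℝ}
    (hI : ∀ J, I J = ∑ a, P.real ((fun ω => (Q ω, (fun i => V i ω), Z ω)) ⁻¹' {a}) *
      infoDensity P pV Q V Z J a) (hrate : ∀ J : Finset (Fin K), I J ≤ ∑ j ∈ J, R j)
    {n : ℕ} (hn : 0 < n) {Qn : Ω → Fin n → 𝒬}
    {Vn : ∀ i, Fin (numIdx n (R i)) → Ω → Fin n → 𝒱 i} (hcb : IsRandomCodebook μ pQ pV Qn Vn)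
    {L : ∀ i, Ω → Fin (numIdx n (R i))} (hL : ∀ i, Measurable (L i)) {Zn : Ω → Fin n → 𝒵}
    (hZn : Measurable Zn) {ε G : ℝ} (hG0 : 0 ≤ G)
    (hG : ∀ D, ε * ∑ a, P.real ((fun ω => (Q ω, (fun i => V i ω), Z ω)) ⁻¹' {a}) *
      |infoDensity P pV Q V Z Finset.univ a - infoDensity P pV Q V Z D a| ≤ G) :
    condEntropy μ (fun ω i => L i ω) (fun ω => (Zn ω, Qn ω, codebook Qn Vn ω)) ≤
      1 + n * ∑ j, R j * (1 - μ.real {ω | (fun t => (Qn ω t, (fun i => Vn i (L i ω) ω t), Zn ω t)) ∈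
        typicalSet P (fun ω₀ => (Q ω₀, (fun i => V i ω₀), Z ω₀)) ε n}) +
      (Real.logb 2 (Fintype.card 𝒵) + K * Real.logb 2 (2 * n) +
        n * (∑ j, R j - I Finset.univ + G)) + 2 / n := by
  classical
  have hn1 : (1 : ℝ) ≤ n := by exact_mod_cast hn
  have hcZ : (1 : ℝ) ≤ Fintype.card 𝒵 := by exact_mod_cast Fintype.card_pos
  set E : ℝ := n * (∑ j, R j - I Finset.univ + G) with hE
  have hE0 : 0 ≤ E := mul_nonneg (by positivity) (by linarith [hrate Finset.univ])
  set T := typicalSet P (fun ω₀ => (Q ω₀, (fun i => V i ω₀), Z ω₀)) ε n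
  have hB1 : (1 : ℝ) ≤ (2 * n) ^ K := one_le_pow₀ (by linarith)
  have hB2 : (1 : ℝ) ≤ 2 ^ E := Real.one_le_rpow one_le_two hE0
  have hmom : ∀ z : Fin n → 𝒵, ∫ ω, ({l : ∀ i, Fin (numIdx n (R i)) |
      (fun t => ((codebook Qn Vn ω).1 t, (fun i => (codebook Qn Vn ω).2 i (l i) t), z t)) ∈
        T}.ncard : ℝ) ^ n ∂μ ≤ ((2 * n : ℝ) ^ K * 2 ^ E) ^ n := by
    intro z
    refine hcb.integral_ncard_pow_le z T
      (β := fun D => (2 : ℝ) ^ (-(n * (I Finset.univ - I D - G))))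
      (fun D => by positivity) (fun q hq D l u => ?_) ?_ le_rfl
    · refine (hcb.measureReal_typical_le hlaw hm q hq z D l u (hG D)).trans (le_of_eq ?_)
      simp only [hI, mul_sub, Finset.sum_sub_distrib]
    · have := sum_card_mul_packing_le hn hrate G
      rwa [Fintype.card_fin] at this
  have hmomZ := hcb.integral_ncard_pow_le_of_dependent hZn T hmom
  rw [← mul_pow] at hmomZ
  have hY : ∀ y, MeasurableSet ((fun ω => (Zn ω, Qn ω, codebook Qn Vn ω)) ⁻¹' {y}) := fun y =>
    (hZn.prodMk (hcb.measurable_Q.prodMk hcb.measurable_codebook)) (measurableSet_singleton y)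
  have hLm : ∀ l, MeasurableSet ((fun ω i => L i ω) ⁻¹' {l}) := fun l =>
    (measurable_pi_lambda _ hL) (measurableSet_singleton l)
  have hcard : (Fintype.card (∀ i, Fin (numIdx n (R i))) : ℝ) ≤ 2 ^ (n * ∑ j, R j) := by
    rw [Fintype.card_pi, Finset.mul_sum, Real.rpow_sum_of_pos two_pos]
    push_cast
    refine Finset.prod_le_prod (fun i _ => Nat.cast_nonneg _) fun i _ => ?_
    rw [Fintype.card_fin]
    exact Nat.floor_le (by positivity)
  have hmain := condEntropy_le_of_integral_ncard_pow_le μ hLm hY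
    (fun l y => (fun t => (y.2.2.1 t, (fun i => y.2.2.2 i (l i) t), y.1 t)) ∈ T) hcard
    (one_le_mul_of_one_le_of_one_le hcZ (one_le_mul_of_one_le_of_one_le hB1 hB2)) hn hmomZ
  have hlog : Real.logb 2 (Fintype.card 𝒵 * ((2 * n : ℝ) ^ K * 2 ^ E)) =
      Real.logb 2 (Fintype.card 𝒵) + K * Real.logb 2 (2 * n) + E := by
    rw [Real.logb_mul (by positivity) (by positivity), Real.logb_mul (by positivity)
      (by positivity), Real.logb_pow, Real.logb_rpow two_pos (by norm_num)]
    ring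
  rw [hlog] at hmain
  rw [← Finset.sum_mul, ← mul_assoc]
  exact hmain

end Main

end Equivocation

theorem lemma3
    {K : ℕ} {𝒬 𝒵 : Type*} {𝒱 : Fin K → Type*}
    [Fintype 𝒬] [MeasurableSpace 𝒬] [DiscreteMeasurableSpace 𝒬]
    [Fintype 𝒵] [MeasurableSpace 𝒵] [DiscreteMeasurableSpace 𝒵]
    [∀ i, Fintype (𝒱 i)] [∀ i, MeasurableSpace (𝒱 i)] [∀ i, DiscreteMeasurableSpace (𝒱 i)]
    -- the rates
    (R : Fin K → ℝ) (hR : ∀ i, 0 ≤ R i)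
    -- the single-letter random variables `(Q, V₁, …, V_K, Z)` and their law
    (pQ : PMF 𝒬) (pV : ∀ i, 𝒬 → PMF (𝒱 i)) (pZ : (∀ i, 𝒱 i) → PMF 𝒵)
    {Ω₀ : Type*} [MeasurableSpace Ω₀] (P : Measure Ω₀) [IsProbabilityMeasure P]
    (Q : Ω₀ → 𝒬) (V : ∀ i, Ω₀ → 𝒱 i) (Z : Ω₀ → 𝒵)
    (hQ : Measurable Q) (hV : ∀ i, Measurable (V i)) (hZ : Measurable Z)
    (hlaw : Equivocation.HasSourceLaw P pQ pV pZ Q V Z)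
    -- the rate constraints
    (hrate : ∀ J : Finset (Fin K),
      Equivocation.condMutualInfo P (fun ω (j : J) => V j ω) Z Q ≤ ∑ j ∈ J, R j) :
    ∃ δ : ℕ → ℝ → ℝ,
      Tendsto (fun x : ℕ × ℝ => δ x.1 x.2) (atTop ×ˢ 𝓝[>] (0 : ℝ)) (𝓝 0) ∧
      ∀ ε : ℝ, 0 < ε →
      ∀ (Ω : ℕ → Type*) [∀ n, MeasurableSpace (Ω n)]
        (μ : ∀ n, Measure (Ω n)) [∀ n, IsProbabilityMeasure (μ n)]
        (Qn : ∀ n, Ω n → Fin n → 𝒬)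
        (Vn : ∀ n i, Fin (Equivocation.numIdx n (R i)) → Ω n → Fin n → 𝒱 i)
        (L : ∀ n i, Ω n → Fin (Equivocation.numIdx n (R i)))
        (Zn : ∀ n, Ω n → Fin n → 𝒵),
        (∀ n, Equivocation.IsRandomCodebook (μ n) pQ pV (Qn n) (Vn n)) →
        (∀ n i, Measurable (L n i)) →
        (∀ n, Measurable (Zn n)) →
        Tendsto (fun n => (μ n).real
          {ω | (fun t => (Qn n ω t, (fun i => Vn n i (L n i ω) ω t), Zn n ω t)) ∈
            Equivocation.typicalSet P (fun ω₀ => (Q ω₀, (fun i => V i ω₀), Z ω₀)) ε n})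
          atTop (𝓝 1) →
        ∀ᶠ n in atTop,
          Equivocation.condEntropy (μ n) (fun ω i => L n i ω)
              (fun ω => (Zn n ω, Qn n ω, Equivocation.codebook (Qn n) (Vn n) ω)) ≤
            n * ((∑ j, R j) -
              Equivocation.condMutualInfo P
                (fun ω (j : (Finset.univ : Finset (Fin K))) => V j ω) Z Q)
            + n * δ n ε := by
  have hm : ∀ a, MeasurableSet ((fun ω => (Q ω, (fun i => V i ω), Z ω)) ⁻¹' {a}) := fun a =>
    (hQ.prodMk ((measurable_pi_lambda _ hV).prodMk hZ)) (measurableSet_singleton a)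
  have hI := Equivocation.condMutualInfo_eq_sum_infoDensity hlaw hm
    (fun i x => hV i (measurableSet_singleton x)) (fun q => hQ (measurableSet_singleton q))
    (fun z => hZ (measurableSet_singleton z))
  have : Nonempty 𝒵 := (nonempty_of_isProbabilityMeasure P).map Z
  let A : Finset (Fin K) → ℝ := fun D =>
    ∑ a, P.real ((fun ω => (Q ω, (fun i => V i ω), Z ω)) ⁻¹' {a}) *
      |Equivocation.infoDensity P pV Q V Z Finset.univ a -
        Equivocation.infoDensity P pV Q V Z D a|
  have hA : ∀ D, 0 ≤ A D := fun D =>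
    Finset.sum_nonneg fun a _ => mul_nonneg measureReal_nonneg (abs_nonneg _)
  set b := Real.logb 2 (Fintype.card 𝒵) + 3 with hb
  refine ⟨fun n ε => ε * (∑ D, A D + ∑ j, R j) + (b + K * Real.logb 2 (2 * n)) / n,
    Equivocation.tendsto_mul_add_logb_div_atTop _ b K, ?_⟩
  intro ε hε Ω _ μ _ Qn Vn L Zn hcb hL hZn hT
  -- The probability of the atypical event need not be bounded in terms of `n` and `ε` alone; that
  -- it is eventually at most `ε` is enough.
  filter_upwards [hT.eventually (lt_mem_nhds (sub_lt_self 1 hε)), eventually_gt_atTop 0]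
    with n hn hn0
  have hn1 : (1 : ℝ) ≤ n := by exact_mod_cast hn0
  have hmain := (hcb n).condEntropy_le hlaw hm hI hrate hn0 (hL n) (hZn n)
    (G := ε * ∑ D, A D) (mul_nonneg hε.le (Finset.sum_nonneg fun D _ => hA D)) fun D =>
      mul_le_mul_of_nonneg_left (Finset.single_le_sum (f := A) (fun D _ => hA D)
        (Finset.mem_univ D)) hε.le
  refine hmain.trans ?_
  rw [← Finset.sum_mul]
  have hR0 : 0 ≤ ∑ j, R j := Finset.sum_nonneg fun i _ => hR i
  have h1 : n * ((∑ j, R j) * (1 - (μ n).real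
      {ω | (fun t => (Qn n ω t, (fun i => Vn n i (L n i ω) ω t), Zn n ω t)) ∈
        Equivocation.typicalSet P (fun ω₀ => (Q ω₀, (fun i => V i ω₀), Z ω₀)) ε n})) ≤
      n * ((∑ j, R j) * ε) := by
    gcongr
    linarith
  have h2 : 2 / (n : ℝ) ≤ 2 := div_le_self zero_le_two hn1
  have h3 : n * (ε * (∑ D, A D + ∑ j, R j) + (b + K * Real.logb 2 (2 * n)) / n) =
      n * (ε * (∑ D, A D + ∑ j, R j)) + (b + K * Real.logb 2 (2 * n)) := by
    field_simp
  rw [h3]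
  linarith
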